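/- All graphs are finite and simple. For a graph $G$ and a partition $\mathcal P$ of $V(G)$, a $\mathcal P$-flip of $G$ is a graph obtained by choosing a set of unordered pairs $A,B\in\mathcal P$ (possibly $A=B$) and complementing the adjacency of all distinct $u\in A$, $v\in B$ for every chosen pair; a $k$-flip is a $\mathcal P$-flip with $|\mathcal P|\le k$. In the flipper game of radius $r$ on $G$, the runner first chooses $v_0\in V(G)$, and $G_0=G$; in round $i\ge 1$ flipper announces a graph $G_i$ on $V(G)$, and then the runner moves to a vertex $v_i$ along a path of length at most $r$ in $G_{i-1}$ from $v_{i-1}$. Flipper wins if at some point $v_i$ is isolated in $G_i$. The flip-width $\operatorname{fw}_r(G)$ is the least $k\ge 1$ such that flipper has a winning strategy in which every announced $G_i$ ($i\ge1$) is a $k$-flip of $G$. In the Cops and Robber game of radius $r$ and width $k$ on $G$, the robber first chooses $w_0\in V(G)$, and $C_0=\emptyset$; in round $i\ge 1$ the cops announce a set $C_i\subseteq V(G)$ with $|C_i|\le k$, and then the robber moves from $w_{i-1}$ to a vertex $w_i$ along a path in $G$ of length at most $r$ avoiding $C_{i-1}\cap C_i$. The cops win if at some point $w_i\in C_i$. The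 cop-width $\operatorname{copwidth}_r(G)$ is the least $k$ for which the cops have a winning strategy. **Theorem.** (1) Let $r,t\in\mathbb N$, let $G$ be a graph that does not contain $K_{t,t}$ as a subgraph, and let $k=\operatorname{fw}_{3r}(G)$. Then flipper has a winning strategy in the flipper game of radius $r$ on $G$ in which every announced graph is obtained from $G$ by isolating at most $k\,t^2$ vertices (removing all edges incident to them). Moreover, $$\operatorname{copwidth}_r(G)\le 2\cdot\operatorname{fw}_{3r}(G)\cdot t^2 .$$ (2) Let $\mathcal C$ be a class of graphs that is weakly sparse (for some $t\in\mathbb N$, no member of $\mathcal C$ contains $K_{t,t}$ as a subgraph) and has bounded flip-width (for every $r\in\mathbb N$ there is $c_r\in\mathbb N$ with $\operatorname{fw}_r(G)<c_r$ for all $G\in\mathcal C$). Then $\mathcal C$ has bounded expansion: for every $r\in\mathbb N$ there is $d_r\in\mathbb N$ such that $|E(H)|\le d_r\,|V(H)|$ for every depth-$r$ minor $H$ of every $G\in\mathcal C$. Here $H$ is a depth-$r$ minor of $G$ if there are pairwise disjoint sets $B_w\subseteq V(G)$, $w\in V(H)$, each inducing a connected subgraph of $G$ of radius at most $r$, such that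 $G$ has an edge between $B_w$ and $B_{w'}$ whenever $ww'\in E(H)$. -/

import Mathlib

universe u

/-- A finite simple graph, with its vertex type. A class of graphs is a set of these. -/
structure FiniteGraph : Type (u + 1) where
  /-- The vertices. -/
  V : Type u
  /-- The vertex type is finite. -/
  finite : Finite V
  /-- The graph on these vertices. -/
  graph : SimpleGraph V

namespace FlipWidth

variable {V : Type*}

/-! ### Flips and isolations -/

/-- `H` is obtained from `G` by flipping a collection of (unordered) pairs of parts of `P`,
possibly with both parts equal: `F A B` says that the pair `A`, `B` is flipped. -/
def IsPartitionFlip (P : Set (Set V)) (G H : SimpleGraph V) : Prop :=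
  ∃ F : Set V → Set V → Prop, (∀ A B, F A B → F B A) ∧
    ∀ A ∈ P, ∀ B ∈ P, ∀ u ∈ A, ∀ v ∈ B,
      H.Adj u v ↔ u ≠ v ∧ Xor (G.Adj u v) (F A B)

/-- `H` is a `k`-flip of `G`: a flip along some partition of the vertices into at most `k` parts. -/
def IsFlip (k : ℕ) (G H : SimpleGraph V) : Prop :=
  ∃ P : Set (Set V), Setoid.IsPartition P ∧ P.Finite ∧ P.ncard ≤ k ∧ IsPartitionFlip P G H

/-- The graph obtained from `G` by isolating the vertices in `S`, that is, by removing all edges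
incident to them. -/
def isolate (G : SimpleGraph V) (S : Finset V) : SimpleGraph V where
  Adj u v := G.Adj u v ∧ u ∉ S ∧ v ∉ S
  symm := ⟨fun _ _ h => ⟨h.1.symm, h.2.2, h.2.1⟩⟩
  loopless := ⟨fun _ h => h.1.ne rfl⟩

/-- `H` arises from `G` by isolating at most `m` vertices. -/
def IsIsolation (m : ℕ) (G H : SimpleGraph V) : Prop :=
  ∃ S : Finset V, S.card ≤ m ∧ H = isolate G S

/-! ### The flipper game -/

/-- The graph `G_i` in the play in which flipper follows the strategy `σ` and runner visits
`v 0, v 1, …`: initially `G_0 = G`, and `G_{i+1}` is the reply of the strategy to the positions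
`v 0, …, v i` visited so far. -/
def gameGraph (G : SimpleGraph V) (σ : List V → SimpleGraph V) (v : ℕ → V) : ℕ → SimpleGraph V
  | 0 => G
  | i + 1 => σ ((List.range (i + 1)).map v)

/-- Against the strategy `σ`, the sequence `v` follows the rules of the runner of speed `r`:
in round `i + 1` the runner moves along a path of length at most `r` in the previous graph `G_i`. -/
def IsRunnerPlay (G : SimpleGraph V) (r : ℕ∞) (σ : List V → SimpleGraph V) (v : ℕ → V) : Prop :=
  ∀ i, ∃ p : (gameGraph G σ v i).Walk (v i) (v (i + 1)), p.IsPath ∧ (p.length : ℕ∞) ≤ r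

/-- `σ` is a winning strategy of flipper in the flipper game of radius `r` on `G`: whatever the
runner does, at some point his position `v i` is isolated in `G_i`. (The runner may always stay
where he is, so every unfinished play extends to an infinite sequence.) -/
def IsWinningFlipperStrategy (G : SimpleGraph V) (r : ℕ∞) (σ : List V → SimpleGraph V) : Prop :=
  ∀ v : ℕ → V, IsRunnerPlay G r σ v → ∃ i, ∀ u, ¬ (gameGraph G σ v i).Adj (v i) u

/-- Flipper has a winning strategy in the flipper game of radius `r` on `G` in which all the graphs
he announces satisfy `M`. -/
def FlipperWins (G : SimpleGraph V) (r : ℕ∞) (M : SimpleGraph V → Prop) : Prop :=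
  ∃ σ : List V → SimpleGraph V, (∀ h, M (σ h)) ∧ IsWinningFlipperStrategy G r σ

/-- The radius-`r` flip-width: the least width `k ≥ 1` such that flipper wins the flipper game of
radius `r` and width `k`, in which the announced graphs are `k`-flips of `G`. -/
noncomputable def flipWidth (r : ℕ∞) (G : SimpleGraph V) : ℕ :=
  sInf {k | 1 ≤ k ∧ FlipperWins G r (IsFlip k G)}

/-- On a finite graph some width is sufficient for flipper. -/
theorem flipWidth_set_nonempty [Finite V] (r : ℕ∞) (G : SimpleGraph V) :
    {k | 1 ≤ k ∧ FlipperWins G r (IsFlip k G)}.Nonempty := by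
  refine ⟨(Set.range fun v : V => ({v} : Set V)).ncard + 1, by simp, fun _ => ⊥, fun _ => ?_, ?_⟩
  · refine ⟨Set.range fun v : V => ({v} : Set V), ⟨?_, ?_⟩, Set.toFinite _, by omega, ?_⟩
    · rintro ⟨v, hv⟩
      exact Set.singleton_ne_empty v hv
    · intro a
      refine ⟨{a}, ⟨⟨a, rfl⟩, rfl⟩, ?_⟩
      rintro _ ⟨⟨b, rfl⟩, hb⟩
      have hab : a = b := hb
      simp [hab]
    · refine ⟨fun A B => ∃ a ∈ A, ∃ b ∈ B, G.Adj a b, ?_, ?_⟩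
      · rintro A B ⟨a, ha, b, hb, hab⟩
        exact ⟨b, hb, a, ha, hab.symm⟩
      · rintro _ ⟨a, rfl⟩ _ ⟨b, rfl⟩ u hu v hv
        have hua : u = a := hu
        have hvb : v = b := hv
        subst hua hvb
        simp [Xor]
  · exact fun v _ => ⟨1, fun u h => h⟩

/-! ### The Cops and Robber game -/

/-- The set `C_i` of the cops' positions in the play in which they follow the strategy `τ` and the
robber visits `w 0, w 1, …`: initially `C_0 = ∅`, and `C_{i+1}` is the reply of the strategy to the
positions `w 0, …, w i` visited so far. -/
def copPositions (τ : List V → Finset V) (w : ℕ → V) : ℕ → Finset V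
  | 0 => ∅
  | i + 1 => τ ((List.range (i + 1)).map w)

/-- Against the strategy `τ`, the sequence `w` follows the rules of the robber of speed `r`: in
round `i + 1` he moves along a path of length at most `r` in `G` that avoids all cops which are not
moving, that is, the vertices in both `C_i` and `C_{i+1}`. -/
def IsRobberPlay (G : SimpleGraph V) (r : ℕ∞) (τ : List V → Finset V) (w : ℕ → V) : Prop :=
  ∀ i, ∃ p : G.Walk (w i) (w (i + 1)), p.IsPath ∧ (p.length : ℕ∞) ≤ r ∧
    ∀ x ∈ p.support, ¬ (x ∈ copPositions τ w i ∧ x ∈ copPositions τ w (i + 1))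

/-- The cops have a winning strategy in the Cops and Robber game of radius `r` and width `k`: at
most `k` cops are placed in each round, and whatever the robber does, at some point `w i ∈ C_i`.
(A robber who is not caught may always stay where he is, so the plays in which he is never caught
are exactly the infinite sequences ruled out here.) -/
def CopsWin (G : SimpleGraph V) (r : ℕ∞) (k : ℕ) : Prop :=
  ∃ τ : List V → Finset V, (∀ h, (τ h).card ≤ k) ∧
    ∀ w : ℕ → V, IsRobberPlay G r τ w → ∃ i, w i ∈ copPositions τ w i

/-- The radius-`r` cop-width: the least number of cops with a winning strategy. -/
noncomputable def copWidth (r : ℕ∞) (G : SimpleGraph V) : ℕ :=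
  sInf {k | CopsWin G r k}

/-- On a finite graph some number of cops is sufficient. -/
theorem copWidth_set_nonempty [Finite V] (r : ℕ∞) (G : SimpleGraph V) :
    {k | CopsWin G r k}.Nonempty := by
  have := Fintype.ofFinite V
  exact ⟨Fintype.card V, fun _ => Finset.univ, fun _ => le_rfl,
    fun w _ => ⟨1, Finset.mem_univ _⟩⟩

/-! ### Classes of graphs -/

/-- `G` is `K_{t,t}`-free: no subgraph of `G` is isomorphic to the biclique `K_{t,t}`. -/
def BicliqueFree (t : ℕ) (G : SimpleGraph V) : Prop :=
  (completeBipartiteGraph (Fin t) (Fin t)).Free G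

/-- A class is weakly sparse if for some `t` all its members are `K_{t,t}`-free. -/
def WeaklySparse (C : Set FiniteGraph.{u}) : Prop :=
  ∃ t : ℕ, ∀ G ∈ C, BicliqueFree t G.graph

/-- A class has bounded flip-width if for every radius `r ∈ ℕ` the radius-`r` flip-width of its
members is bounded. -/
def BoundedFlipWidth (C : Set FiniteGraph.{u}) : Prop :=
  ∀ r : ℕ, ∃ c : ℕ, ∀ G ∈ C, flipWidth (r : ℕ∞) G.graph < c

/-- `H` is a depth-`r` minor of `G`: there are pairwise disjoint branch sets `B w` in `G`, one for
each vertex `w` of `H`, each inducing a connected subgraph of radius at most `r` (in particular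
non-empty), such that adjacent vertices of `H` have branch sets joined by an edge of `G`. -/
def IsShallowMinor {W : Type*} (r : ℕ) (H : SimpleGraph W) (G : SimpleGraph V) : Prop :=
  ∃ B : W → Set V,
    (∀ w w', w ≠ w' → Disjoint (B w) (B w')) ∧
    (∀ w, ∃ c : B w, ∀ x : B w, ∃ p : (G.induce (B w)).Walk c x, p.length ≤ r) ∧
    ∀ w w', H.Adj w w' → ∃ x ∈ B w, ∃ y ∈ B w', G.Adj x y

/-- A class has bounded expansion if for every `r` there is a bound on the edge density
`|E(H)| / |V(H)|` of all depth-`r` minors `H` of its members. -/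
def BoundedExpansion (C : Set FiniteGraph.{u}) : Prop :=
  ∀ r : ℕ, ∃ c : ℕ, ∀ G ∈ C, ∀ H : FiniteGraph.{u}, IsShallowMinor r H.graph G.graph →
    H.graph.edgeSet.ncard ≤ c * Nat.card H.V

end FlipWidth

/-! In a `K_{t,t}`-free graph flips can be traded for isolations. Across a flipped pair of parts,
non-edges of `G` become edges, so two vertices with many non-neighbours on the opposite side are
joined by a walk of length at most 3 in the flip. Isolating small parts and the few vertices with
too few non-neighbours in a large part thus leaves only edges that the flip simulates
(`IsFlip.exists_isolate_walk`), and tripling the radius pays for this. Cops then imitate isolations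
by occupying two consecutive isolated sets (`FlipperWins.copsWin`).

For bounded expansion, winning cops yield small local separators (`CopsWin.exists_separator`), hence
a vertex order in which every vertex weakly reaches boundedly many others (`CopsWin.exists_ranking`,
`mem_iterReach`). Each edge of a shallow minor becomes a weak reachability between the least
vertices of its branch sets. -/

namespace FlipWidth

open Finset

/-! ### Replacing flips by isolations -/

section Flips

variable {V : Type*} {G H : SimpleGraph V}

theorem BicliqueFree.pos {t : ℕ} (hG : BicliqueFree t G) : 0 < t := by
  rcases Nat.eq_zero_or_pos t with rfl | h
  · exact absurd (SimpleGraph.completeBipartiteGraph_isContained_iff.2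
      ⟨∅, ∅, by simp, by simp, by simp [SimpleGraph.IsCompleteBetween]⟩) hG
  · exact h

theorem BicliqueFree.exists_not_adj {t : ℕ} (hG : BicliqueFree t G) {X Y : Finset V}
    (hX : t ≤ #X) (hY : t ≤ #Y) : ∃ x ∈ X, ∃ y ∈ Y, ¬ G.Adj x y := by
  by_contra! h
  obtain ⟨X', hX', hXt⟩ := Finset.exists_subset_card_eq hX
  obtain ⟨Y', hY', hYt⟩ := Finset.exists_subset_card_eq hY
  exact hG (SimpleGraph.completeBipartiteGraph_isContained_iff.2
    ⟨X', Y', by simpa using hXt, by simpa using hYt,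
      fun x hx y hy => h x (hX' hx) y (hY' hy)⟩)

open Classical in
/-- In a `K_{t,t}`-free graph, fewer than `t` vertices have fewer than `t` non-neighbours in a given
set of at least `t ^ 2` vertices. -/
theorem BicliqueFree.card_few_nonneighbors_lt [Fintype V] {t : ℕ} (hG : BicliqueFree t G)
    {B : Finset V} (hB : t ^ 2 ≤ #B) : #{u | #{x ∈ B | ¬ G.Adj u x} < t} < t := by
  by_contra! h
  obtain ⟨U, hU, hUt⟩ := Finset.exists_subset_card_eq h
  -- Each of the `t` vertices misses at most `t - 1` of `B`, so at least `t ^ 2 - t * (t - 1) = t`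
  -- vertices of `B` are adjacent to all of them: a biclique.
  have hbad : #(U.biUnion fun u => {x ∈ B | ¬ G.Adj u x}) ≤ t * (t - 1) := by
    rw [← hUt]
    refine Finset.card_biUnion_le_card_mul _ _ _ fun u hu => ?_
    have := (Finset.mem_filter.1 (hU hu)).2
    omega
  have hcommon : t ≤ #(B \ U.biUnion fun u => {x ∈ B | ¬ G.Adj u x}) := by
    have h1 := Finset.le_card_sdiff (U.biUnion fun u => {x ∈ B | ¬ G.Adj u x}) B
    have h2 : t * (t - 1) + t = t ^ 2 := by
      obtain ⟨s, rfl⟩ := Nat.exists_eq_add_of_lt hG.pos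
      simp only [zero_add, Nat.add_sub_cancel]
      ring
    omega
  obtain ⟨u, hu, x, hx, hux⟩ := hG.exists_not_adj hUt.ge hcommon
  simp only [mem_sdiff, mem_biUnion, mem_filter, not_exists, not_and] at hx
  exact hx.2 u hu hx.1 hux

theorem exists_walk_length_le_one {u v : V} (h : u ≠ v → H.Adj u v) :
    ∃ p : H.Walk u v, p.length ≤ 1 := by
  by_cases huv : u = v
  · subst huv
    exact ⟨.nil, by simp⟩
  · exact ⟨(h huv).toWalk, by simp⟩

open Classical in
/-- A `k`-flip of a `K_{t,t}`-free graph `G` can be undone, up to stretching edges to walks of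
length at most three, at the price of isolating `k * t ^ 2` vertices. -/
theorem IsFlip.exists_isolate_walk [Fintype V] {k t : ℕ} (hG : BicliqueFree t G)
    (hH : IsFlip k G H) : ∃ S : Finset V, #S ≤ k * t ^ 2 ∧
      ∀ u v, (isolate G S).Adj u v → ∃ p : H.Walk u v, p.length ≤ 3 := by
  obtain ⟨P, hP, hfin, hcard, F, hF, hflip⟩ := hH
  let few (B : Set V) : Finset V := {u | #{x ∈ B.toFinset | ¬ G.Adj u x} < t}
  let S (B : Set V) : Finset V := if #B.toFinset < t ^ 2 then B.toFinset else few B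
  have hS : ∀ B, #(S B) ≤ t ^ 2 := by
    intro B
    by_cases hB : #B.toFinset < t ^ 2
    · simp only [S, if_pos hB]
      exact hB.le
    · simp only [S, if_neg hB]
      refine (hG.card_few_nonneighbors_lt (not_lt.1 hB)).le.trans ?_
      exact Nat.le_self_pow two_ne_zero t
  refine ⟨hfin.toFinset.biUnion S, ?_, ?_⟩
  · refine (Finset.card_biUnion_le_card_mul _ _ _ fun B _ => hS B).trans ?_
    rw [← Set.ncard_eq_toFinset_card P hfin]
    exact Nat.mul_le_mul_right _ hcard
  rintro u v ⟨huv, hu, hv⟩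
  obtain ⟨A, ⟨hA, huA⟩, -⟩ := hP.2 u
  obtain ⟨B, ⟨hB, hvB⟩, -⟩ := hP.2 v
  have hu' : ∀ D ∈ P, u ∉ S D := by simpa using hu
  have hv' : ∀ D ∈ P, v ∉ S D := by simpa using hv
  by_cases hAB : F A B
  · have hAbig : ¬ #A.toFinset < t ^ 2 := fun h =>
      hu' A hA (by simp only [S, if_pos h]; simpa using huA)
    have hBbig : ¬ #B.toFinset < t ^ 2 := fun h =>
      hv' B hB (by simp only [S, if_pos h]; simpa using hvB)
    have huB : t ≤ #{x ∈ B.toFinset | ¬ G.Adj u x} := by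
      have := hu' B hB
      simp only [S, if_neg hBbig, few, mem_filter, mem_univ, true_and] at this
      exact not_lt.1 this
    have hvA : t ≤ #{x ∈ A.toFinset | ¬ G.Adj v x} := by
      have := hv' A hA
      simp only [S, if_neg hAbig, few, mem_filter, mem_univ, true_and] at this
      exact not_lt.1 this
    -- The walk in `H` is `u, x, y, v`, each step a non-edge of `G` between `A` and `B`.
    -- Coincidences such as `x = u` only shorten it.
    obtain ⟨x, hx, y, hy, hxy⟩ := hG.exists_not_adj huB hvA
    simp only [mem_filter, Set.mem_toFinset] at hx hy
    have step : ∀ a ∈ A, ∀ b ∈ B, ¬ G.Adj a b → a ≠ b → H.Adj a b := fun a ha b hb hab hne =>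
      (hflip A hA B hB a ha b hb).2 ⟨hne, Or.inr ⟨hAB, hab⟩⟩
    obtain ⟨p, hp⟩ := exists_walk_length_le_one (step u huA x hx.1 hx.2)
    obtain ⟨q, hq⟩ := exists_walk_length_le_one (step y hy.1 x hx.1 fun h => hxy h.symm)
    obtain ⟨s, hs⟩ := exists_walk_length_le_one (step y hy.1 v hvB fun h => hy.2 h.symm)
    refine ⟨(p.append q.reverse).append s, ?_⟩
    simp only [SimpleGraph.Walk.length_append, SimpleGraph.Walk.length_reverse]
    omega
  · have : H.Adj u v := (hflip A hA B hB u huA v hvB).2 ⟨huv.ne, Or.inl ⟨huv, hAB⟩⟩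
    exact ⟨this.toWalk, by simp⟩

theorem exists_walk_length_le_mul {n : ℕ}
    (h : ∀ u v, G.Adj u v → ∃ p : H.Walk u v, p.length ≤ n) {u v : V} (p : G.Walk u v) :
    ∃ q : H.Walk u v, q.length ≤ n * p.length := by
  induction p with
  | nil => exact ⟨.nil, by simp⟩
  | cons hadj p ih =>
    obtain ⟨q, hq⟩ := ih
    obtain ⟨s, hs⟩ := h _ _ hadj
    refine ⟨s.append q, ?_⟩
    simp only [SimpleGraph.Walk.length_append, SimpleGraph.Walk.length_cons, mul_add, mul_one]
    omega

-- Every move in the isolated graphs is also a move, three times as long, against the original flip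
-- strategy, so that strategy must trap the runner too.
open Classical in
theorem FlipperWins.isolation [Finite V] {k r t : ℕ} (hG : BicliqueFree t G)
    (h : FlipperWins G (3 * (r : ℕ∞)) (IsFlip k G)) :
    FlipperWins G (r : ℕ∞) (IsIsolation (k * t ^ 2) G) := by
  have := Fintype.ofFinite V
  obtain ⟨σ, hσ, hwin⟩ := h
  choose S hS hwalk using fun l => (hσ l).exists_isolate_walk hG
  refine ⟨fun l => isolate G (S l), fun l => ⟨S l, hS l, rfl⟩, fun v hv => ?_⟩
  have hsim : ∀ i, ∀ x y, (gameGraph G (fun l => isolate G (S l)) v i).Adj x y →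
      ∃ p : (gameGraph G σ v i).Walk x y, p.length ≤ 3 := by
    rintro (_ | i) x y hxy
    · change G.Adj x y at hxy
      change ∃ p : G.Walk x y, p.length ≤ 3
      exact ⟨hxy.toWalk, by simp⟩
    · exact hwalk _ x y hxy
  obtain ⟨i, hi⟩ := hwin v fun i => by
    obtain ⟨p, -, hp⟩ := hv i
    obtain ⟨q, hq⟩ := exists_walk_length_le_mul (hsim i) p
    refine ⟨q.bypass, q.bypass_isPath, ?_⟩
    have hp' : p.length ≤ r := by exact_mod_cast hp
    have h1 := q.length_bypass_le_length
    have h2 : q.bypass.length ≤ 3 * r := by omega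
    exact_mod_cast h2
  -- An edge at `v i` after isolation would give a non-trivial walk leaving `v i` in the flip, where
  -- it is isolated.
  refine ⟨i, fun u hu => ?_⟩
  obtain ⟨p, -⟩ := hsim i _ _ hu
  cases p with
  | nil => exact hu.ne rfl
  | cons h _ => exact hi _ h

end Flips

/-! ### Cops from isolations, separators from cops -/

section Cops

variable {V : Type*} {G : SimpleGraph V}

theorem CopsWin.mono {r : ℕ∞} {k l : ℕ} (hkl : k ≤ l) (h : CopsWin G r k) : CopsWin G r l := by
  obtain ⟨τ, hτ, hwin⟩ := h
  exact ⟨τ, fun l => (hτ l).trans hkl, hwin⟩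

open Classical in
/-- The reply of the cops who simulate a flipper isolating the set `s l` after the history `l`: they
keep the previously isolated set occupied, and move to the newly isolated set, or to the robber's
position if he is trapped there. -/
noncomputable def copReply (G : SimpleGraph V) (s : List V → Finset V) (l : List V) : Finset V :=
  s l.dropLast ∪ match l.getLast? with
    | none => ∅
    | some x => if ∀ y, ¬ (isolate G (s l.dropLast)).Adj x y then {x} else s l

theorem card_copReply_le {s : List V → Finset V} {m : ℕ} (hm : 1 ≤ m) (hs : ∀ l, #(s l) ≤ m)
    (l : List V) : #(copReply G s l) ≤ 2 * m := by
  classical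
  rw [copReply, two_mul]
  convert (Finset.card_union_le _ _).trans (add_le_add (hs _) _) using 1
  split
  · simp
  · split
    · simpa using hm
    · exact hs l

open Classical in
theorem copPositions_copReply (s : List V → Finset V) (w : ℕ → V) (i : ℕ) :
    copPositions (copReply G s) w (i + 1) = s ((List.range i).map w) ∪
      if ∀ y, ¬ (isolate G (s ((List.range i).map w))).Adj (w i) y then {w i}
      else s ((List.range (i + 1)).map w) := by
  simp only [copPositions, copReply, List.range_succ, List.map_append, List.map_cons, List.map_nil,
    List.dropLast_concat, List.getLast?_concat]

theorem exists_isolate_path {S : Finset V} {u v : V} (p : G.Walk u v) (hp : p.IsPath)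
    (hS : ∀ x ∈ p.support, x ∉ S) :
    ∃ q : (isolate G S).Walk u v, q.IsPath ∧ q.length = p.length := by
  have h : ∀ e ∈ p.edges, e ∈ (isolate G S).edgeSet := by
    intro e he
    induction e with | _ a b
    exact ⟨p.adj_of_mem_edges he, hS _ (p.fst_mem_support_of_mem_edges he),
      hS _ (p.snd_mem_support_of_mem_edges he)⟩
  exact ⟨p.transfer _ h, hp.transfer h, p.length_transfer h⟩

-- The set isolated in `G_i` is occupied in both `C_i` and `C_{i+1}`, so the robber's move is a
-- legal runner move in `G_i`. Once he is isolated there he cannot leave, and one cop lands on him.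
open Classical in
theorem FlipperWins.copsWin {r : ℕ∞} {m : ℕ} (hm : 1 ≤ m)
    (h : FlipperWins G r (IsIsolation m G)) : CopsWin G r (2 * m) := by
  obtain ⟨σ, hσ, hwin⟩ := h
  choose s₀ hs₀ hσs using hσ
  -- The empty history isolates nothing, matching `G_0 = G` and `C_0 = ∅`.
  let s (l : List V) : Finset V := if l = [] then ∅ else s₀ l
  have hs : ∀ l, #(s l) ≤ m := by
    intro l
    by_cases hl : l = []
    · simp [s, hl]
    · simpa [s, hl] using hs₀ l
  refine ⟨copReply G s, card_copReply_le hm hs, fun w hw => ?_⟩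
  by_contra! hfree
  have hgraph : ∀ i, gameGraph G σ w i = isolate G (s ((List.range i).map w)) := by
    rintro (_ | i)
    · ext x y
      simp [gameGraph, isolate, s]
    · simp [gameGraph, hσs, s]
  -- the set isolated in round `i` is occupied throughout the robber's next move
  have hocc : ∀ i, s ((List.range i).map w) ⊆ copPositions (copReply G s) w (i + 1) := by
    intro i
    rw [copPositions_copReply]
    exact Finset.subset_union_left
  have htrap : ∀ i, s ((List.range i).map w) ⊆ copPositions (copReply G s) w i →
      ∃ q : (gameGraph G σ w i).Walk (w i) (w (i + 1)), q.IsPath ∧ (q.length : ℕ∞) ≤ r := by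
    intro i hi
    obtain ⟨p, hp, hr, hav⟩ := hw i
    obtain ⟨q, hq, hlen⟩ := exists_isolate_path p hp
      (S := s ((List.range i).map w)) fun x hx hxs => hav x hx ⟨hi hxs, hocc i hxs⟩
    rw [← hlen] at hr
    rw [hgraph]
    exact ⟨q, hq, hr⟩
  have hkey : ∀ i, s ((List.range i).map w) ⊆ copPositions (copReply G s) w i ∧
      ∃ y, (gameGraph G σ w i).Adj (w i) y := by
    have hmoves : ∀ i, s ((List.range i).map w) ⊆ copPositions (copReply G s) w i →
        ∃ y, (gameGraph G σ w i).Adj (w i) y := by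
      intro i hi
      by_contra! hiso
      obtain ⟨q, -⟩ := htrap i hi
      have hstay : w (i + 1) = w i := by
        generalize w (i + 1) = z at q
        cases q with
        | nil => rfl
        | cons h _ => exact (hiso _ h).elim
      refine hfree (i + 1) ?_
      rw [hgraph] at hiso
      rw [copPositions_copReply, if_pos hiso, hstay]
      simp
    intro i
    induction i with
    | zero =>
      have h0 : s ((List.range 0).map w) ⊆ copPositions (copReply G s) w 0 := by simp [s]
      exact ⟨h0, hmoves 0 h0⟩
    | succ i ih =>
      have h1 : s ((List.range (i + 1)).map w) ⊆ copPositions (copReply G s) w (i + 1) := by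
        obtain ⟨y, hy⟩ := ih.2
        rw [hgraph] at hy
        rw [copPositions_copReply, if_neg fun h => h y hy]
        exact Finset.subset_union_right
      exact ⟨h1, hmoves _ h1⟩
  obtain ⟨i, hi⟩ := hwin w fun i => htrap i (hkey i).1
  obtain ⟨y, hy⟩ := (hkey i).2
  exact hi y hy

/-- If the cops win, then every non-empty set has a vertex that few vertices separate, at bounded
distance, from the rest of the set: otherwise the robber could evade the cops inside the set. -/
theorem CopsWin.exists_separator {r k : ℕ} (h : CopsWin G (r : ℕ∞) k) {U : Finset V}
    (hU : U.Nonempty) : ∃ u ∈ U, ∃ C : Finset V, #C ≤ k ∧ ∀ x ∈ U, x ≠ u →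
      ∀ p : G.Walk u x, p.length ≤ r → ∃ y ∈ p.support, y ≠ u ∧ y ∈ C := by
  classical
  by_contra! hide
  have hmove : ∀ u (C : Finset V), u ∈ U → #C ≤ k → ∃ x, x ∈ U ∧ x ∉ C ∧
      ∃ p : G.Walk u x, p.IsPath ∧ p.length ≤ r ∧ ∀ y ∈ p.support, y ≠ u → y ∉ C := by
    intro u C hu hC
    -- The robber moves only when a cop is about to land on him.
    by_cases huC : u ∈ C
    · obtain ⟨x, hx, hxu, p, hp, hpC⟩ := hide u hu C hC
      exact ⟨x, hx, hpC x p.end_mem_support hxu, p.bypass, p.bypass_isPath,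
        p.length_bypass_le_length.trans hp, fun y hy => hpC y (p.support_bypass_subset_support hy)⟩
    · exact ⟨u, hu, huC, .nil, by simp, by simp, by simp⟩
  choose! next hnextU hnextC hnext using hmove
  obtain ⟨τ, hτ, hwin⟩ := h
  obtain ⟨u₀, hu₀⟩ := hU
  -- The history is carried along because the cops' reply depends on all earlier positions.
  let state (i : ℕ) : V × List V :=
    i.rec (u₀, []) fun _ s => (next s.1 (τ (s.2 ++ [s.1])), s.2 ++ [s.1])
  let w (i : ℕ) : V := (state i).1
  have hhist : ∀ i, (state i).2 = (List.range i).map w := by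
    intro i
    induction i with
    | zero => rfl
    | succ i ih =>
      rw [List.range_succ, List.map_append, ← ih]
      rfl
  have hw : ∀ i, w (i + 1) = next (w i) (copPositions τ w (i + 1)) := by
    intro i
    rw [copPositions, List.range_succ, List.map_append, ← hhist]
    rfl
  have hcard : ∀ i, #(copPositions τ w (i + 1)) ≤ k := fun i => hτ _
  have hwU : ∀ i, w i ∈ U := by
    intro i
    induction i with
    | zero => exact hu₀
    | succ i ih =>
      rw [hw]
      exact hnextU _ _ ih (hcard i)
  have hfree : ∀ i, w i ∉ copPositions τ w i := by
    rintro (_ | i)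
    · simp [copPositions]
    · rw [hw]
      exact hnextC _ _ (hwU i) (hcard i)
  obtain ⟨i, hi⟩ := hwin w fun i => by
    have hpath := hnext _ _ (hwU i) (hcard i)
    rw [← hw] at hpath
    obtain ⟨p, hp, hr, hav⟩ := hpath
    refine ⟨p, hp, by exact_mod_cast hr, fun y hy hyC => ?_⟩
    -- The start may lie in the new cop set, but not in the old one, as the robber was not yet
    -- caught.
    by_cases hyw : y = w i
    · exact hfree i (hyw ▸ hyC.1)
    · exact hav y hy hyw hyC.2
  exact hfree i hi

/-- Vertices are ranked from the top down: the separable vertex of the remaining set gets the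
largest free rank and is removed, so its separator handles all vertices ranked below it. -/
theorem CopsWin.exists_ranking [Finite V] {r k : ℕ} (h : CopsWin G (r : ℕ∞) k) :
    ∃ f : V → ℕ, Function.Injective f ∧ ∃ C : V → Finset V, ∀ v, #(C v) ≤ k ∧
      ∀ u, f u < f v → ∀ p : G.Walk v u, p.length ≤ r → ∃ y ∈ p.support, y ≠ v ∧ y ∈ C v := by
  classical
  have := Fintype.ofFinite V
  have key : ∀ (n : ℕ) (U : Finset V), #U = n → ∃ f : V → ℕ, (∀ v ∈ U, f v < n) ∧
      Set.InjOn f U ∧ ∃ C : V → Finset V, ∀ v ∈ U, #(C v) ≤ k ∧ ∀ u ∈ U, f u < f v →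
        ∀ p : G.Walk v u, p.length ≤ r → ∃ y ∈ p.support, y ≠ v ∧ y ∈ C v := by
    intro n
    induction n with
    | zero =>
      intro U hU
      rw [Finset.card_eq_zero] at hU
      subst hU
      exact ⟨fun _ => 0, by simp, by simp, fun _ => ∅, by simp⟩
    | succ n ih =>
      intro U hU
      obtain ⟨a, ha, C₀, hC₀, hsep⟩ := h.exists_separator (Finset.card_pos.1 (by omega : 0 < #U))
      obtain ⟨f, hf, hinj, C, hC⟩ := ih (U.erase a) (by rw [Finset.card_erase_of_mem ha]; omega)
      have hfa : ∀ v, v ≠ a → Function.update f a n v = f v := fun v hv =>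
        Function.update_of_ne hv _ _
      have hmem : ∀ v ∈ U, v ≠ a → v ∈ U.erase a := fun v hv hne => Finset.mem_erase.2 ⟨hne, hv⟩
      refine ⟨Function.update f a n, ?_, ?_, Function.update C a C₀, ?_⟩
      · intro v hv
        by_cases hva : v = a
        · simp [hva]
        · rw [hfa v hva]
          exact (hf v (hmem v hv hva)).trans (Nat.lt_succ_self n)
      · intro v hv u hu hvu
        by_cases hva : v = a <;> by_cases hua : u = a
        · rw [hva, hua]
        · rw [hva, hfa u hua, Function.update_self] at hvu
          exact absurd hvu (hf u (hmem u hu hua)).ne'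
        · rw [hua, hfa v hva, Function.update_self] at hvu
          exact absurd hvu (hf v (hmem v hv hva)).ne
        · rw [hfa v hva, hfa u hua] at hvu
          exact hinj (hmem v hv hva) (hmem u hu hua) hvu
      · intro v hv
        by_cases hva : v = a
        · subst hva
          simp only [Function.update_self]
          exact ⟨hC₀, fun u hu hlt p hp => hsep u hu (by rintro rfl; simp at hlt) p hp⟩
        · rw [Function.update_of_ne hva, hfa v hva]
          refine ⟨(hC v (hmem v hv hva)).1, fun u hu hlt p hp => ?_⟩
          have hua : u ≠ a := by
            rintro rfl
            rw [Function.update_self] at hlt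
            exact absurd (hf v (hmem v hv hva)) (by omega)
          rw [hfa u hua] at hlt
          exact (hC v (hmem v hv hva)).2 u (hmem u hu hua) hlt p hp
  obtain ⟨f, -, hinj, C, hC⟩ := key _ Finset.univ rfl
  exact ⟨f, fun a b hab => hinj (by simp) (by simp) hab, C, fun v =>
    ⟨(hC v (by simp)).1, fun u => (hC v (by simp)).2 u (by simp)⟩⟩

end Cops

/-! ### Weak reachability and the density of shallow minors -/

section ShallowMinors

variable {V : Type*} {G : SimpleGraph V}

open Classical in
/-- The vertices reached from `v` in at most `j` steps along the set-valued map `C`. -/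
noncomputable def iterReach (C : V → Finset V) : ℕ → V → Finset V
  | 0, v => {v}
  | j + 1, v => insert v ((C v).biUnion (iterReach C j))

theorem self_mem_iterReach (C : V → Finset V) (j : ℕ) (v : V) : v ∈ iterReach C j v := by
  cases j <;> simp [iterReach]

theorem card_iterReach_le {C : V → Finset V} {k : ℕ} (hC : ∀ v, #(C v) ≤ k) (j : ℕ) (v : V) :
    #(iterReach C j v) ≤ (k + 1) ^ j := by
  classical
  induction j generalizing v with
  | zero => simp [iterReach]
  | succ j ih =>
    have h1 : #((C v).biUnion (iterReach C j)) ≤ k * (k + 1) ^ j :=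
      (Finset.card_biUnion_le_card_mul _ _ _ fun z _ => ih z).trans (Nat.mul_le_mul_right _ (hC v))
    have h2 : 1 ≤ (k + 1) ^ j := Nat.one_le_pow _ _ (by omega)
    have h3 := Finset.card_insert_le v ((C v).biUnion (iterReach C j))
    simp only [iterReach]
    rw [pow_succ]
    exact h3.trans (by linarith)

/-- Weakly reachable vertices are found by iterating the separators. -/
theorem mem_iterReach {r : ℕ} {f : V → ℕ} {C : V → Finset V}
    (hC : ∀ v u, f u < f v → ∀ p : G.Walk v u, p.length ≤ r → ∃ y ∈ p.support, y ≠ v ∧ y ∈ C v)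
    {j : ℕ} (hj : j ≤ r) {v u : V} (p : G.Walk v u) (hp : p.length ≤ j)
    (hmin : ∀ x ∈ p.support, x ≠ u → f u < f x) : u ∈ iterReach C j v := by
  classical
  induction j generalizing v with
  | zero =>
    have := SimpleGraph.Walk.eq_of_length_eq_zero (Nat.le_zero.1 hp)
    subst this
    exact self_mem_iterReach C 0 _
  | succ j ih =>
    by_cases hvu : v = u
    · subst hvu
      exact self_mem_iterReach C _ _
    obtain ⟨y, hy, hyv, hyC⟩ := hC v u (hmin v p.start_mem_support hvu) p (hp.trans hj)
    have hsum : (p.takeUntil y hy).length + (p.dropUntil y hy).length = p.length := by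
      rw [← SimpleGraph.Walk.length_append, SimpleGraph.Walk.take_spec]
    -- Since `y ≠ v`, the rest of the walk from `y` is strictly shorter.
    have hpos : (p.takeUntil y hy).length ≠ 0 := fun h0 =>
      hyv (SimpleGraph.Walk.eq_of_length_eq_zero h0).symm
    have := ih (by omega) (p.dropUntil y hy) (by omega)
      fun x hx => hmin x (p.support_dropUntil_subset_support hy hx)
    simp only [iterReach, mem_insert, mem_biUnion]
    exact Or.inr ⟨y, hyC, this⟩

theorem exists_walk_of_induce {s : Set V} {a b : s} (p : (G.induce s).Walk a b) :
    ∃ q : G.Walk (a : V) b, q.length = p.length ∧ ∀ x ∈ q.support, x ∈ s := by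
  induction p with
  | @nil a => exact ⟨.nil, rfl, by simp⟩
  | @cons a c b h p ih =>
    obtain ⟨q, hq, hqs⟩ := ih
    exact ⟨.cons (SimpleGraph.induce_adj.1 h) q, by simp [hq], by simpa using hqs⟩

/-- Least vertices of adjacent branch sets are joined by a walk of length at most `2r + 1 + 2r`
inside the two sets, and its end of lower rank is its minimum. Charging each edge to the end of
higher rank gives the bound. -/
theorem CopsWin.ncard_edgeSet_le [Finite V] {W : Type*} [Finite W] {H : SimpleGraph W} {r k : ℕ}
    (h : CopsWin G ((4 * r + 1 : ℕ) : ℕ∞) k) (hH : IsShallowMinor r H G) :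
    H.edgeSet.ncard ≤ (k + 1) ^ (4 * r + 1) * Nat.card W := by
  classical
  have := Fintype.ofFinite W
  obtain ⟨f, hf, C, hC⟩ := h.exists_ranking
  obtain ⟨B, hdisj, hrad, hadj⟩ := hH
  have hconn : ∀ w, ∀ x ∈ B w, ∀ y ∈ B w, ∃ p : G.Walk x y, p.length ≤ 2 * r ∧
      ∀ z ∈ p.support, z ∈ B w := by
    intro w x hx y hy
    obtain ⟨c, hc⟩ := hrad w
    obtain ⟨p, hp⟩ := hc ⟨x, hx⟩
    obtain ⟨q, hq⟩ := hc ⟨y, hy⟩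
    obtain ⟨s, hs, hsB⟩ := exists_walk_of_induce (p.reverse.append q)
    refine ⟨s, ?_, hsB⟩
    rw [hs, SimpleGraph.Walk.length_append, SimpleGraph.Walk.length_reverse]
    omega
  have hleast : ∀ w, ∃ m ∈ B w, ∀ x ∈ B w, x ≠ m → f m < f x := by
    intro w
    obtain ⟨c, -⟩ := hrad w
    obtain ⟨m, hm, hle⟩ := (Set.toFinite (B w)).exists_minimalFor f _ ⟨c, c.2⟩
    refine ⟨m, hm, fun x hx hne => lt_of_le_of_ne ?_ fun h => hne (hf h).symm⟩
    by_contra! hlt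
    exact absurd (hle hx hlt.le) (not_le.2 hlt)
  choose m hmB hm using hleast
  have hminj : Function.Injective m := by
    intro w w' hww
    by_contra hne
    exact Set.disjoint_left.1 (hdisj w w' hne) (hmB w) (hww ▸ hmB w')
  have hreach : ∀ w w', H.Adj w w' → f (m w) < f (m w') →
      m w ∈ iterReach C (4 * r + 1) (m w') := by
    intro w w' hww hlt
    obtain ⟨x, hx, y, hy, hxy⟩ := hadj w w' hww
    obtain ⟨p, hp, hpB⟩ := hconn w x hx (m w) (hmB w)
    obtain ⟨q, hq, hqB⟩ := hconn w' (m w') (hmB w') y hy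
    refine mem_iterReach (fun v => (hC v).2) le_rfl (q.append (.cons hxy.symm p)) ?_ ?_
    · rw [SimpleGraph.Walk.length_append, SimpleGraph.Walk.length_cons]
      omega
    · intro z hz hne
      rw [SimpleGraph.Walk.mem_support_append_iff, SimpleGraph.Walk.support_cons,
        List.mem_cons] at hz
      have hz' : z ∈ B w' ∨ z ∈ B w := by
        rcases hz with hz | rfl | hz
        · exact Or.inl (hqB z hz)
        · exact Or.inl hy
        · exact Or.inr (hpB z hz)
      rcases hz' with hz | hz
      · by_cases hzm : z = m w'
        · rwa [hzm]
        · exact hlt.trans (hm w' z hz hzm)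
      · exact hm w z hz hne
  let N (w' : W) : Finset W := {w | m w ∈ iterReach C (4 * r + 1) (m w')}
  have hN : ∀ w', #(N w') ≤ (k + 1) ^ (4 * r + 1) := by
    intro w'
    refine (Finset.card_le_card_of_injOn m (fun w hw => ?_) hminj.injOn).trans
      (card_iterReach_le (fun v => (hC v).1) (4 * r + 1) (m w'))
    exact (Finset.mem_filter.1 hw).2
  have hsub : H.edgeSet ⊆
      ((Finset.univ.biUnion fun w' => (N w').image fun w => s(w, w') : Finset (Sym2 W)) :
        Set (Sym2 W)) := by
    intro e he
    induction e with | _ a b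
    have hab : H.Adj a b := he
    have hne : f (m a) ≠ f (m b) := fun h => hab.ne (hminj (hf h))
    simp only [coe_biUnion, coe_univ, Set.mem_univ, Set.iUnion_true, Set.mem_iUnion, coe_image,
      Set.mem_image, N, coe_filter, mem_univ, true_and, Set.mem_ofPred_eq]
    rcases lt_or_gt_of_ne hne with hlt | hlt
    · exact ⟨b, a, hreach a b hab hlt, rfl⟩
    · exact ⟨a, b, hreach b a hab.symm hlt, Sym2.eq_swap⟩
  refine (Set.ncard_le_ncard hsub (Finset.finite_toSet _)).trans ?_
  rw [Set.ncard_coe_finset]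
  refine (Finset.card_biUnion_le_card_mul _ _ _ fun w' _ =>
    Finset.card_image_le.trans (hN w')).trans ?_
  rw [Finset.card_univ, Nat.card_eq_fintype_card, mul_comm]

end ShallowMinors

theorem flipWidth_spec {V : Type*} [Finite V] (r : ℕ∞) (G : SimpleGraph V) :
    1 ≤ flipWidth r G ∧ FlipperWins G r (IsFlip (flipWidth r G) G) :=
  Nat.sInf_mem (flipWidth_set_nonempty r G)

theorem BicliqueFree.copsWin {V : Type*} [Finite V] {G : SimpleGraph V} {t : ℕ}
    (hG : BicliqueFree t G) (r : ℕ) :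
    CopsWin G (r : ℕ∞) (2 * flipWidth (3 * (r : ℕ∞)) G * t ^ 2) := by
  obtain ⟨hpos, hwin⟩ := flipWidth_spec (3 * (r : ℕ∞)) G
  rw [mul_assoc]
  exact (hwin.isolation hG).copsWin (Nat.mul_pos hpos (pow_pos hG.pos 2))

end FlipWidth

theorem theorem4p12 :
    (∀ (V : Type u) [Finite V] (G : SimpleGraph V) (r t : ℕ), FlipWidth.BicliqueFree t G →
      FlipWidth.FlipperWins G (r : ℕ∞)
          (FlipWidth.IsIsolation (FlipWidth.flipWidth (3 * (r : ℕ∞)) G * t ^ 2) G) ∧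
        FlipWidth.copWidth (r : ℕ∞) G ≤ 2 * FlipWidth.flipWidth (3 * (r : ℕ∞)) G * t ^ 2) ∧
    (∀ C : Set FiniteGraph.{u}, FlipWidth.WeaklySparse C → FlipWidth.BoundedFlipWidth C →
      FlipWidth.BoundedExpansion C) := by
  refine ⟨fun V _ G r t hG =>
    ⟨(FlipWidth.flipWidth_spec _ G).2.isolation hG, Nat.sInf_le (hG.copsWin r)⟩, ?_⟩
  rintro C ⟨t, ht⟩ hbdd r
  obtain ⟨c, hc⟩ := hbdd (3 * (4 * r + 1))
  refine ⟨(2 * c * t ^ 2 + 1) ^ (4 * r + 1), fun G hG H hH => ?_⟩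
  have := G.finite
  have := H.finite
  have hle : FlipWidth.flipWidth (3 * ((4 * r + 1 : ℕ) : ℕ∞)) G.graph ≤ c := by
    have := (hc G hG).le
    rwa [Nat.cast_mul, Nat.cast_ofNat] at this
  refine (((ht G hG).copsWin (4 * r + 1)).mono ?_).ncard_edgeSet_le hH
  exact Nat.mul_le_mul_right _ (Nat.mul_le_mul_left _ hle)
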